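/- Let $\mathbb K$ be $\mathbb R$ or $\mathbb C$, $1\le p<\infty$, and let $p'$ be the conjugate exponent, $\frac1p+\frac1{p'}=1$ ($p'=\infty$ if $p=1$). Let $r=(r_n)_{n\ge0}$ and $t=(t_n)_{n\ge0}$ be sequences in $\mathbb K$ without zero terms, $s=(s_n)_{n\ge0}$ a sequence in $\mathbb K$ with $s_0\ne0$, and $u,v\in\mathbb K\setminus\{0\}$. For a sequence $x=(x_k)_{k\ge0}$ put $$(Tx)_n=\frac1{r_n}\sum_{k=0}^{n}s_{n-k}t_k\,(ux_k+vx_{k-1})\qquad(x_{-1}:=0),$$ and let $l_p(r,s,t;B)=\{x: Tx\in l_p\}$ with the norm $\|x\|=\|Tx\|_{l_p}$. Let $c$ be the space of convergent sequences with the supremum norm. Write $A\in(l_p(r,s,t;B),c)$ if $A=(a_{nk})_{n,k\ge0}$ is an infinite matrix such that for every $x\in l_p(r,s,t;B)$ all the series $(Ax)_n=\sum_{k=0}^\infty a_{nk}x_k$ converge and $Ax\in c$; then let $L_Ax=Ax$. For a bounded subset $Q$ of a metric space let $\chi(Q)$ be the infimum of all $\epsilon>0$ such that $Q$ is covered by finitely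 many open balls of radii less than $\epsilon$, and for a bounded linear operator $L$ let $\|L\|_\chi$ be the infimum of all $K\ge0$ with $\chi(L(Q))\le K\chi(Q)$ for all bounded $Q$. Let $D_0=1/s_0$, and for $n\ge1$ let $D_n=s_0^{-(n+1)}\det(s_{i-j+1})_{1\le i,j\le n}$, where $s_m:=0$ for $m<0$. For $n,k\ge0$ define $$\tilde a_{nk}=\lim_{N\to\infty}r_k\Big[\frac{a_{nk}}{s_0t_ku}+\sum_{i=k}^{k+1}(-1)^{i-k}\frac{D_{i-k}}{t_i}\sum_{j=k+1}^{N}\frac{(-v)^{j-i}}{u^{j-i+1}}a_{nj}+\sum_{i=k+2}^{N}(-1)^{i-k}\frac{D_{i-k}}{t_i}\sum_{j=i}^{N}\frac{(-v)^{j-i}}{u^{j-i+1}}a_{nj}\Big].$$ **Theorem.** Let $A\in(l_p(r,s,t;B),c)$. Then $L_A:l_p(r,s,t;B)\to c$ is a bounded linear operator, and $\|L_A\|_\chi=\chi(L_A(S))$, where $S$ is the unit sphere of $l_p(r,s,t;B)$. The limits $\tilde a_{nk}$ and $\tilde\alpha_k=\lim_{n\to\infty}\tilde a_{nk}$ exist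 for all $n,k$, the sequences $\tilde A_n=(\tilde a_{nk})_k$ and $\tilde\alpha=(\tilde\alpha_k)_k$ belong to $l_{p'}$, $\sup_n\|\tilde A_n-\tilde\alpha\|_{l_{p'}}<\infty$, and $$\frac12\limsup_{n\to\infty}\|\tilde A_n-\tilde\alpha\|_{l_{p'}}\ \le\ \|L_A\|_\chi\ \le\ \limsup_{n\to\infty}\|\tilde A_n-\tilde\alpha\|_{l_{p'}}.$$ -/

import Mathlib

open Filter Topology SummationFilter
open scoped ENNReal

noncomputable section

/-- The parameters: sequences `r, t` without zero terms, a sequence `s` with `s 0 ≠ 0`, and the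
two nonzero scalars `u, v` of the band matrix `B = B(u, v)`. -/
structure Weights (𝕜 : Type*) [RCLike 𝕜] where
  r : ℕ → 𝕜
  s : ℕ → 𝕜
  t : ℕ → 𝕜
  u : 𝕜
  v : 𝕜
  r_ne : ∀ n, r n ≠ 0
  t_ne : ∀ n, t n ≠ 0
  s_ne : s 0 ≠ 0
  u_ne : u ≠ 0
  v_ne : v ≠ 0

namespace Weights

variable {𝕜 : Type*} [RCLike 𝕜] (W : Weights 𝕜)

/-- The difference matrix `B(u, v)`: `(B x)_0 = u x_0` and `(B x)_n = v x_{n-1} + u x_n`. -/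
def band (x : ℕ → 𝕜) : ℕ → 𝕜
  | 0 => W.u * x 0
  | n + 1 => W.v * x n + W.u * x (n + 1)

/-- The generalized means `A(r, s, t)`. -/
def genMean (x : ℕ → 𝕜) (n : ℕ) : 𝕜 :=
  (1 / W.r n) * ∑ k ∈ Finset.range (n + 1), W.s (n - k) * W.t k * x k

/-- The transform `y = A(r, s, t; B) x = (A(r, s, t) · B) x`. -/
def transform (x : ℕ → 𝕜) : ℕ → 𝕜 := W.genMean (W.band x)

theorem band_add (x y : ℕ → 𝕜) : W.band (x + y) = W.band x + W.band y := by
  funext n; cases n <;> simp [band] <;> ring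

theorem band_smul (c : 𝕜) (x : ℕ → 𝕜) : W.band (c • x) = c • W.band x := by
  funext n; cases n <;> simp [band] <;> ring

theorem transform_add (x y : ℕ → 𝕜) :
    W.transform (x + y) = W.transform x + W.transform y := by
  funext n
  simp [transform, genMean, band_add, mul_add, Finset.sum_add_distrib]

theorem transform_smul (c : 𝕜) (x : ℕ → 𝕜) :
    W.transform (c • x) = c • W.transform x := by
  funext n
  simp only [transform, genMean, band_smul, Pi.smul_apply, smul_eq_mul, mul_left_comm _ c,
    ← Finset.mul_sum]

theorem transform_injective {x : ℕ → 𝕜} (h : W.transform x = 0) : x = 0 := by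
  have hb : ∀ n, W.band x n = 0 := by
    intro n
    induction n using Nat.strong_induction_on with
    | _ n ih =>
      have h1 := congrFun h n
      simp only [transform, genMean, Pi.zero_apply] at h1
      rw [Finset.sum_range_succ, Finset.sum_eq_zero (fun k hk => by
        rw [ih k (Finset.mem_range.1 hk), mul_zero])] at h1
      simpa [W.r_ne n, W.t_ne n, W.s_ne] using h1
  funext n
  induction n with
  | zero => simpa [band, W.u_ne] using hb 0
  | succ n ih =>
    have h1 := hb (n + 1)
    simp only [Pi.zero_apply] at ih
    simpa [band, W.u_ne, ih] using h1

/-- The space `l_p(r, s, t; B)` of all sequences whose transform lies in `l_p`, as a set of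
sequences. -/
def seqSpace (p : ℝ≥0∞) : Submodule 𝕜 (ℕ → 𝕜) where
  carrier := {x | Memℓp (W.transform x) p}
  zero_mem' := by
    have h : W.transform (0 : ℕ → 𝕜) = 0 := by simpa using W.transform_smul 0 0
    simpa [h] using (zero_memℓp : Memℓp (0 : ℕ → 𝕜) p)
  add_mem' {x y} hx hy := by
    simpa [W.transform_add] using Memℓp.add hx hy
  smul_mem' c x hx := by
    simpa [W.transform_smul] using Memℓp.const_smul hx c

/-- The space `l_p(r, s, t; B)` as a type of its own; it carries the norm below, not the product
topology of the space of all sequences. -/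
def Space (p : ℝ≥0∞) : Type _ := ↥(W.seqSpace p)

instance (p : ℝ≥0∞) : AddCommGroup (W.Space p) := inferInstanceAs (AddCommGroup ↥(W.seqSpace p))

instance (p : ℝ≥0∞) : Module 𝕜 (W.Space p) := inferInstanceAs (Module 𝕜 ↥(W.seqSpace p))

/-- The sequence underlying an element of `l_p(r, s, t; B)`. -/
def toSeq (p : ℝ≥0∞) : W.Space p →ₗ[𝕜] (ℕ → 𝕜) := (W.seqSpace p).subtype

theorem toSeq_mem {p : ℝ≥0∞} (x : W.Space p) : W.toSeq p x ∈ W.seqSpace p := Subtype.prop x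

/-- The map `x ↦ y = A(r, s, t; B) x` from `l_p(r, s, t; B)` to `l_p`. -/
def toLp (p : ℝ≥0∞) : W.Space p →ₗ[𝕜] lp (fun _ : ℕ => 𝕜) p where
  toFun x := ⟨W.transform (W.toSeq p x), W.toSeq_mem x⟩
  map_add' x y := by
    apply lp.ext
    simp only [map_add, W.transform_add]
    rfl
  map_smul' c x := by
    apply lp.ext
    simp only [map_smul, W.transform_smul]
    rfl

theorem toLp_injective (p : ℝ≥0∞) : Function.Injective (W.toLp p) := by
  rw [injective_iff_map_eq_zero]
  intro x hx
  have h : W.transform (W.toSeq p x) = 0 := congrArg (fun z : lp (fun _ : ℕ => 𝕜) p => (z : ℕ → 𝕜)) hx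
  exact Subtype.ext (W.transform_injective h)

/-- The norm of `l_p(r, s, t; B)`: `‖x‖ = ‖A(r, s, t; B) x‖` in `l_p`. -/
instance (p : ℝ≥0∞) [Fact (1 ≤ p)] : NormedAddCommGroup (W.Space p) :=
  NormedAddCommGroup.induced _ _ (W.toLp p) (W.toLp_injective p)

instance (p : ℝ≥0∞) [Fact (1 ≤ p)] : NormedSpace 𝕜 (W.Space p) :=
  NormedSpace.induced 𝕜 _ _ (W.toLp p)

/-- `D_n^{(s)} = s_0^{-(n+1)} det M_n`, where `M_n` is the `n × n` Toeplitz-Hessenberg matrix with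
`s_1` on the diagonal, `s_0` right above it, zeros further up, and `s_2, s_3, …` below the
diagonal; `D_0^{(s)} = 1 / s_0`. -/
def D (n : ℕ) : 𝕜 :=
  1 / W.s 0 ^ (n + 1) *
    (Matrix.of fun i j : Fin n =>
      if (j : ℕ) ≤ (i : ℕ) + 1 then W.s ((i : ℕ) + 1 - (j : ℕ)) else 0).det

/-- For a sequence `a`, the expression
`r_k [ a_k / (s_0 t_k u) + ∑_{i=k}^{k+1} (-1)^{i-k} (D_{i-k} / t_i) ∑_{j=k+1}^{N} (-v)^{j-i} / u^{j-i+1} a_j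
  + ∑_{i=k+2}^{N} (-1)^{i-k} (D_{i-k} / t_i) ∑_{j=i}^{N} (-v)^{j-i} / u^{j-i+1} a_j ]`
for `k ≤ N`, and `0` for `k > N`. -/
def tildeTrunc (a : ℕ → 𝕜) (N k : ℕ) : 𝕜 :=
  if k ≤ N then
    W.r k * (a k / (W.s 0 * W.t k) * (1 / W.u)
      + ∑ i ∈ Finset.Icc k (k + 1), (-1) ^ (i - k) * (W.D (i - k) / W.t i) *
          ∑ j ∈ Finset.Icc (k + 1) N, (-W.v) ^ (j - i) / W.u ^ (j - i + 1) * a j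
      + ∑ i ∈ Finset.Icc (k + 2) N, (-1) ^ (i - k) * (W.D (i - k) / W.t i) *
          ∑ j ∈ Finset.Icc i N, (-W.v) ^ (j - i) / W.u ^ (j - i + 1) * a j)
  else 0

end Weights

section MatrixMaps

variable {𝕜 : Type*} [RCLike 𝕜]

/-- The `A`-transform `(A x)_n = ∑_{k=0}^∞ a_{nk} x_k`; the series is the limit of its partial
sums. -/
def matTransform (A : Matrix ℕ ℕ 𝕜) (x : ℕ → 𝕜) (n : ℕ) : 𝕜 :=
  ∑'[conditional ℕ] k, A n k * x k

/-- The class `(U, V)` of infinite matrices: for every `x ∈ U` all the series `(A x)_n` converge,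
and `A x ∈ V`. -/
def MatClass (U V : Set (ℕ → 𝕜)) : Set (Matrix ℕ ℕ 𝕜) :=
  {A | ∀ x ∈ U, (∀ n, Summable (fun k => A n k * x k) (conditional ℕ)) ∧ matTransform A x ∈ V}

variable (𝕜) in
/-- The set of convergent sequences. -/
def convSeq : Set (ℕ → 𝕜) := {z | ∃ l, Tendsto z atTop (𝓝 l)}

theorem memℓp_of_convSeq {z : ℕ → 𝕜} (hz : z ∈ convSeq 𝕜) : Memℓp z ∞ := by
  obtain ⟨l, hl⟩ := hz
  exact memℓp_infty hl.norm.bddAbove_range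

variable (𝕜) in
/-- The Banach space `c` of convergent sequences with the supremum norm. -/
def cSpace : Submodule 𝕜 (lp (fun _ : ℕ => 𝕜) ∞) where
  carrier := {z | (z : ℕ → 𝕜) ∈ convSeq 𝕜}
  zero_mem' := ⟨0, tendsto_const_nhds⟩
  add_mem' {x y} hx hy := by
    obtain ⟨l, hl⟩ := hx
    obtain ⟨m, hm⟩ := hy
    exact ⟨l + m, hl.add hm⟩
  smul_mem' c x hx := by
    obtain ⟨l, hl⟩ := hx
    exact ⟨c • l, hl.const_smul c⟩

/-- The operator `L_A : l_p(r, s, t; B) → c`, `L_A x = A x`, of a matrix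
`A ∈ (l_p(r, s, t; B), c)`. -/
def matOp {W : Weights 𝕜} {p : ℝ≥0∞} {A : Matrix ℕ ℕ 𝕜}
    (hA : A ∈ MatClass (W.seqSpace p : Set (ℕ → 𝕜)) (convSeq 𝕜)) :
    W.Space p →ₗ[𝕜] cSpace 𝕜 where
  toFun x := ⟨⟨matTransform A (W.toSeq p x), memℓp_of_convSeq (hA _ (W.toSeq_mem x)).2⟩,
    (hA _ (W.toSeq_mem x)).2⟩
  map_add' x y := by
    apply Subtype.ext
    apply lp.ext
    funext n
    have hx := (hA _ (W.toSeq_mem x)).1 n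
    have hy := (hA _ (W.toSeq_mem y)).1 n
    change matTransform A _ n = matTransform A _ n + matTransform A _ n
    simp [matTransform, mul_add, hx.tsum_add hy]
  map_smul' c x := by
    apply Subtype.ext
    apply lp.ext
    funext n
    have hx := (hA _ (W.toSeq_mem x)).1 n
    change matTransform A _ n = c * matTransform A _ n
    simp [matTransform, mul_left_comm _ c, hx.tsum_mul_left c]

end MatrixMaps

section Noncompactness

/-- The Hausdorff measure of noncompactness of a (bounded) set `Q`: the infimum of all `ε > 0` such
that `Q` is covered by finitely many open balls of radii less than `ε`. -/
def hausdorffMNC {X : Type*} [PseudoMetricSpace X] (Q : Set X) : ℝ :=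
  sInf {ε : ℝ | 0 < ε ∧ ∃ (n : ℕ) (x : Fin (n + 1) → X) (ρ : Fin (n + 1) → ℝ),
    (∀ i, 0 < ρ i ∧ ρ i < ε) ∧ Q ⊆ ⋃ i, Metric.ball (x i) (ρ i)}

/-- The Hausdorff measure of noncompactness `‖L‖_χ` of a (bounded linear) operator `L`: the infimum
of all `K ≥ 0` such that `χ(L(Q)) ≤ K χ(Q)` for every bounded set `Q`. -/
def opMNC {X Y : Type*} [PseudoMetricSpace X] [PseudoMetricSpace Y] (L : X → Y) : ℝ :=
  sInf {K : ℝ | 0 ≤ K ∧ ∀ Q : Set X, Bornology.IsBounded Q →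
    hausdorffMNC (L '' Q) ≤ K * hausdorffMNC Q}

end Noncompactness

end

/-! The triangular map `transform` is an isometry of `l_p(r,s,t;B)` onto `l_p`; the `k`-th column of
its inverse is `basisSeq k`, whose entries involve the determinants `D` because these are, up to
sign, the coefficients of `1 / ∑ s_n X^n` (`D_eq`). Carried over to `l_p`, row `n` of `A` becomes a
continuous functional `f n` (`exists_row_functional`). Its coefficients are the limits of
`tildeTrunc` (`tildeTrunc_eq`), and its norm is their `l_q` norm (`norm_lpDualSeq`). The `f n`
converge pointwise to some `g`, hence are uniformly bounded.

What remains concerns any operator into `c` with coordinates `F n → G` pointwise. Upper bound: the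
first coordinates and the limit form a finite-rank, hence totally bounded, part, and the tail
deviates from its limit by at most `‖F n - G‖`. Lower bound: in a ball of radius `ρ` about a
convergent `z`, both the `n`-th coordinate and the limit move by at most `ρ`, so `‖F n - G‖` is
asymptotically at most `2ρ`; hence the factor 1/2. -/

/-! ### The dual of `l_p` -/

section DualOfLp

variable {𝕜 : Type*} [RCLike 𝕜] {p q : ℝ≥0∞} [Fact (1 ≤ p)]

/-- The coefficients of a continuous functional on `l_p` with respect to the unit vectors. -/
noncomputable def lpDualCoeff (f : StrongDual 𝕜 (lp (fun _ : ℕ => 𝕜) p)) (k : ℕ) : 𝕜 :=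
  f (lp.single p k 1)

theorem norm_lpDualCoeff_le (f : StrongDual 𝕜 (lp (fun _ : ℕ => 𝕜) p)) (k : ℕ) :
    ‖lpDualCoeff f k‖ ≤ ‖f‖ := by
  have h := f.le_opNorm (lp.single p k 1)
  rwa [lp.norm_single (zero_lt_one.trans_le Fact.out), norm_one, mul_one] at h

theorem apply_lpSingle (f : StrongDual 𝕜 (lp (fun _ : ℕ => 𝕜) p)) (k : ℕ) (c : 𝕜) :
    f (lp.single p k c) = c * lpDualCoeff f k := by
  have h : lp.single (E := fun _ : ℕ => 𝕜) p k c = c • lp.single p k (1 : 𝕜) := by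
    rw [← lp.single_smul, smul_eq_mul, mul_one]
  rw [h, map_smul, smul_eq_mul, lpDualCoeff]

/-- The extremal vector of Hölder's inequality, cut to `s`, satisfies `f y = ‖y‖ ^ P`; boundedness
of `f` then gives `‖y‖ ^ (P - 1) ≤ ‖f‖`. -/
theorem sum_norm_lpDualCoeff_rpow_le (hpq : p.toReal.HolderConjugate q.toReal)
    (f : StrongDual 𝕜 (lp (fun _ : ℕ => 𝕜) p)) (s : Finset ℕ) :
    ∑ k ∈ s, ‖lpDualCoeff f k‖ ^ q.toReal ≤ ‖f‖ ^ q.toReal := by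
  set a := lpDualCoeff f
  set P := p.toReal
  set Q := q.toReal
  -- Where `a k = 0` the conjugate factor makes `g k` vanish, whatever value the power `0 ^ (Q - 2)`
  -- takes.
  let g : ℕ → 𝕜 := fun k => (starRingEnd 𝕜) (a k) * ((‖a k‖ ^ (Q - 2) : ℝ) : 𝕜)
  have hQ : 0 < Q := hpq.symm.pos
  have hmul : ∀ k, g k * a k = ((‖a k‖ ^ Q : ℝ) : 𝕜) := by
    intro k
    rcases eq_or_ne (a k) 0 with h | h
    · simp [g, h, Real.zero_rpow hQ.ne']
    · have h' : 0 < ‖a k‖ := norm_pos_iff.2 h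
      have : ‖a k‖ ^ Q = ‖a k‖ ^ 2 * ‖a k‖ ^ (Q - 2) := by
        rw [← Real.rpow_natCast, ← Real.rpow_add h']; congr 1; push_cast; ring
      rw [this]
      simp only [g]
      rw [mul_right_comm, RCLike.conj_mul]
      push_cast
      rfl
  have hnorm : ∀ k, ‖g k‖ ^ P = ‖a k‖ ^ Q := by
    intro k
    rcases eq_or_ne (a k) 0 with h | h
    · simp [g, h, Real.zero_rpow hQ.ne', Real.zero_rpow hpq.pos.ne']
    · have h' : 0 < ‖a k‖ := norm_pos_iff.2 h
      have : ‖g k‖ = ‖a k‖ ^ (Q - 1) := by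
        simp only [g]
        rw [norm_mul, RCLike.norm_conj, RCLike.norm_ofReal, abs_of_nonneg (by positivity)]
        nth_rewrite 1 [← Real.rpow_one ‖a k‖]
        rw [← Real.rpow_add h']; congr 1; ring
      rw [this, ← Real.rpow_mul h'.le, hpq.symm.sub_one_mul_conj]
  set y : lp (fun _ : ℕ => 𝕜) p := ∑ k ∈ s, lp.single p k (g k)
  have hy : ‖y‖ ^ P = ∑ k ∈ s, ‖a k‖ ^ Q := by
    rw [lp.norm_sum_single hpq.pos]
    exact Finset.sum_congr rfl fun k _ => hnorm k
  have hfy : f y = ((∑ k ∈ s, ‖a k‖ ^ Q : ℝ) : 𝕜) := by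
    simp only [y, map_sum, apply_lpSingle]
    exact Finset.sum_congr rfl fun k _ => hmul k
  have hle : ‖y‖ ^ P ≤ ‖f‖ * ‖y‖ := by
    have h := f.le_opNorm y
    rwa [hfy, RCLike.norm_ofReal, ← hy, abs_of_nonneg (by positivity)] at h
  rw [← hy]
  rcases eq_or_lt_of_le (norm_nonneg y) with h0 | h0
  · rw [← h0, Real.zero_rpow hpq.pos.ne']; positivity
  · have h1 : ‖y‖ ^ (P - 1) ≤ ‖f‖ := by
      rw [Real.rpow_sub_one h0.ne', div_le_iff₀ h0]; exact hle
    calc ‖y‖ ^ P = (‖y‖ ^ (P - 1)) ^ Q := by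
          rw [← Real.rpow_mul h0.le, hpq.sub_one_mul_conj]
      _ ≤ ‖f‖ ^ Q := by gcongr

theorem memℓp_lpDualCoeff (hp : p ≠ ∞) (hpq : p.HolderConjugate q)
    (f : StrongDual 𝕜 (lp (fun _ : ℕ => 𝕜) p)) : Memℓp (lpDualCoeff f) q := by
  by_cases hq : q = ∞
  · subst hq
    exact memℓp_infty ⟨‖f‖, by rintro _ ⟨k, rfl⟩; exact norm_lpDualCoeff_le f k⟩
  · exact memℓp_gen' (sum_norm_lpDualCoeff_rpow_le
      (ENNReal.HolderConjugate.toReal_of_ne_top hp hq) f)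

/-- The element of `l_q` that represents a continuous functional on `l_p`. -/
noncomputable def lpDualSeq (hp : p ≠ ∞) (hpq : p.HolderConjugate q)
    (f : StrongDual 𝕜 (lp (fun _ : ℕ => 𝕜) p)) : lp (fun _ : ℕ => 𝕜) q :=
  ⟨lpDualCoeff f, memℓp_lpDualCoeff hp hpq f⟩

theorem lpDualSeq_sub (hp : p ≠ ∞) (hpq : p.HolderConjugate q)
    (f g : StrongDual 𝕜 (lp (fun _ : ℕ => 𝕜) p)) :
    lpDualSeq hp hpq (f - g) = lpDualSeq hp hpq f - lpDualSeq hp hpq g := rfl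

/-- One inequality comes from the test vectors, the other from Hölder after expanding `y` in unit
vectors, which needs `p ≠ ∞`. -/
theorem norm_lpDualSeq (hp : p ≠ ∞) (hpq : p.HolderConjugate q)
    (f : StrongDual 𝕜 (lp (fun _ : ℕ => 𝕜) p)) : ‖lpDualSeq hp hpq f‖ = ‖f‖ := by
  have : Fact (1 ≤ q) := ⟨ENNReal.HolderConjugate.one_le q p⟩
  apply le_antisymm
  · by_cases hq : q = ∞
    · subst hq
      exact lp.norm_le_of_forall_le (norm_nonneg f) (norm_lpDualCoeff_le f)
    · have hr := ENNReal.HolderConjugate.toReal_of_ne_top hp hq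
      exact lp.norm_le_of_forall_sum_le hr.symm.pos (norm_nonneg f)
        (sum_norm_lpDualCoeff_rpow_le hr f)
  · have hB : ∀ _ : ℕ, ‖ContinuousLinearMap.mul 𝕜 𝕜‖ ≤ ((1 : NNReal) : ℝ) :=
      fun _ => ContinuousLinearMap.opNorm_mul_le 𝕜 𝕜
    set T := lp.dualPairing p q (fun _ : ℕ => ContinuousLinearMap.mul 𝕜 𝕜) hB with hT
    refine f.opNorm_le_bound (norm_nonneg _) fun y => ?_
    have hf : f y = T y (lpDualSeq hp hpq f) := by
      rw [hT, lp.dualPairing_apply, ← ((lp.hasSum_single hp y).map f f.continuous).tsum_eq]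
      exact tsum_congr fun k => apply_lpSingle f k (y k)
    have h1 : ‖T y (lpDualSeq hp hpq f)‖ ≤ 1 * ‖y‖ * ‖lpDualSeq hp hpq f‖ :=
      T.le_of_opNorm₂_le_of_le (lp.norm_dualPairing _ hB) le_rfl le_rfl
    rw [hf]
    simpa [mul_comm] using h1

end DualOfLp

/-! ### Inversion of the transform -/

namespace Weights

variable {𝕜 : Type*} [RCLike 𝕜] (W : Weights 𝕜)

/-- The coefficients of the multiplicative inverse of the power series `∑ s_n X^n`. -/
noncomputable def invCoeff (n : ℕ) : 𝕜 := PowerSeries.coeff n (PowerSeries.mk W.s)⁻¹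

theorem sum_s_mul_invCoeff (m : ℕ) :
    ∑ i ∈ Finset.range (m + 1), W.s (m - i) * W.invCoeff i = if m = 0 then 1 else 0 := by
  have h : (PowerSeries.mk W.s)⁻¹ * PowerSeries.mk W.s = 1 :=
    PowerSeries.inv_mul_cancel _ (by simpa using W.s_ne)
  have h1 := congrArg (PowerSeries.coeff m) h
  rw [PowerSeries.coeff_mul, PowerSeries.coeff_one, Finset.Nat.sum_antidiagonal_eq_sum_range_succ
    (fun i j => PowerSeries.coeff i (PowerSeries.mk W.s)⁻¹ * PowerSeries.coeff j _)] at h1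
  rw [← h1]
  refine Finset.sum_congr rfl fun i _ => ?_
  rw [PowerSeries.coeff_mk, invCoeff, mul_comm]

/-- The lower triangular Toeplitz matrix of size `n + 1` built from `s`. -/
def toeplitz (n : ℕ) : Matrix (Fin (n + 1)) (Fin (n + 1)) 𝕜 :=
  Matrix.of fun i j => if (j : ℕ) ≤ (i : ℕ) then W.s ((i : ℕ) - (j : ℕ)) else 0

theorem det_toeplitz (n : ℕ) : (W.toeplitz n).det = W.s 0 ^ (n + 1) := by
  rw [Matrix.det_of_isLowerTriangular]
  · simp [toeplitz]
  · intro i j hij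
    have : (i : ℕ) < j := hij
    simp only [toeplitz, Matrix.of_apply, if_neg (not_le.2 this)]

theorem toeplitz_mulVec_invCoeff (n : ℕ) :
    (W.toeplitz n).mulVec (fun j => W.invCoeff j) = Pi.single 0 1 := by
  funext i
  have h1 : (W.toeplitz n).mulVec (fun j => W.invCoeff j) i =
      ∑ j ∈ Finset.range (n + 1), (if j ≤ (i : ℕ) then W.s (i - j) else 0) * W.invCoeff j := by
    rw [Finset.sum_range]
    rfl
  rw [h1, ← Finset.sum_subset (Finset.range_mono (Nat.succ_le_of_lt i.isLt))]
  · have h2 := W.sum_s_mul_invCoeff i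
    rw [Pi.single_apply]
    simp only [Fin.ext_iff, Fin.val_zero]
    rw [← h2]
    refine Finset.sum_congr rfl fun j hj => ?_
    rw [if_pos (Nat.lt_succ_iff.1 (Finset.mem_range.1 hj))]
  · intro j _ hj
    rw [if_neg, zero_mul]
    simpa [Nat.lt_succ_iff] using hj

/-- Cramer's rule for the last unknown of the Toeplitz system: deleting row 0 and the last column
leaves the Hessenberg matrix defining `D n`, and the cofactor sign is `(-1) ^ n`. -/
theorem D_eq (n : ℕ) : W.D n = (-1) ^ n * W.invCoeff n := by
  have h := congrArg (fun w => (W.toeplitz n).adjugate.mulVec w (Fin.last n))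
    (W.toeplitz_mulVec_invCoeff n)
  simp only [Matrix.mulVec_mulVec, Matrix.adjugate_mul, Matrix.smul_mulVec, Matrix.one_mulVec,
    Matrix.mulVec_single_one, Matrix.col_apply, Pi.smul_apply, smul_eq_mul, det_toeplitz,
    Fin.val_last] at h
  rw [Matrix.adjugate_fin_succ_eq_det_submatrix] at h
  have hM : (W.toeplitz n).submatrix (Fin.succAbove 0) (Fin.succAbove (Fin.last n)) =
      Matrix.of fun i j : Fin n =>
        if (j : ℕ) ≤ (i : ℕ) + 1 then W.s ((i : ℕ) + 1 - (j : ℕ)) else 0 := by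
    refine Matrix.ext fun i j => ?_
    simp only [Matrix.submatrix_apply, toeplitz, Matrix.of_apply, Fin.succAbove_zero,
      Fin.succAbove_last, Fin.val_succ, Fin.val_castSucc]
  rw [hM] at h
  have hs : W.s 0 ^ (n + 1) ≠ 0 := pow_ne_zero _ W.s_ne
  have hsq : ((-1 : 𝕜) ^ n) * (-1) ^ n = 1 := by rw [← mul_pow]; simp
  rw [D, one_div, inv_mul_eq_iff_eq_mul₀ hs, mul_left_comm, h]
  simp [← mul_assoc, hsq]

theorem sum_s_mul_D (m : ℕ) :
    ∑ i ∈ Finset.range (m + 1), W.s (m - i) * ((-1) ^ i * W.D i) = if m = 0 then 1 else 0 := by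
  rw [← W.sum_s_mul_invCoeff]
  refine Finset.sum_congr rfl fun i _ => ?_
  rw [D_eq, ← mul_assoc ((-1 : 𝕜) ^ i), ← mul_pow]
  simp

/-- The inverse of the band matrix. -/
def invBand (z : ℕ → 𝕜) (j : ℕ) : 𝕜 :=
  ∑ i ∈ Finset.range (j + 1), (-W.v) ^ (j - i) / W.u ^ (j - i + 1) * z i

theorem invBand_succ (z : ℕ → 𝕜) (j : ℕ) :
    W.invBand z (j + 1) = z (j + 1) / W.u - W.v / W.u * W.invBand z j := by
  have hu := W.u_ne
  rw [invBand, Finset.sum_range_succ, invBand, Finset.mul_sum, add_comm, sub_eq_add_neg,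
    ← Finset.sum_neg_distrib]
  congr 1
  · simp [div_eq_inv_mul]
  · refine Finset.sum_congr rfl fun i hi => ?_
    have h : j + 1 - i = (j - i) + 1 := by have := Finset.mem_range.1 hi; omega
    rw [h]
    field_simp
    ring

theorem band_invBand (z : ℕ → 𝕜) : W.band (W.invBand z) = z := by
  have hu := W.u_ne
  funext n
  cases n with
  | zero => simp [band, invBand, hu]
  | succ n =>
    rw [band, invBand_succ]
    field_simp
    ring

/-- The preimage of the `k`-th unit vector under the generalized means. -/
def invMean (k i : ℕ) : 𝕜 :=
  if k ≤ i then W.r k * ((-1) ^ (i - k) * (W.D (i - k) / W.t i)) else 0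

theorem genMean_invMean (k : ℕ) : W.genMean (W.invMean k) = Pi.single k 1 := by
  funext n
  rw [genMean]
  rcases lt_or_ge n k with h | h
  · rw [Finset.sum_eq_zero, mul_zero, Pi.single_eq_of_ne h.ne]
    intro i hi
    rw [invMean, if_neg, mul_zero]
    have := Finset.mem_range.1 hi
    omega
  · obtain ⟨m, rfl⟩ := Nat.exists_eq_add_of_le h
    rw [add_assoc, Finset.range_eq_Ico,
      ← Finset.sum_Ico_consecutive _ (Nat.zero_le k) (Nat.le_add_right k (m + 1)),
      Finset.sum_Ico_eq_sum_range _ k, Nat.add_sub_cancel_left, Finset.sum_eq_zero, zero_add]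
    · have h1 : ∀ i ∈ Finset.range (m + 1), W.s (k + m - (k + i)) * W.t (k + i) *
          W.invMean k (k + i) = W.r k * (W.s (m - i) * ((-1) ^ i * W.D i)) := by
        intro i _
        have ht := W.t_ne (k + i)
        rw [invMean, if_pos (by omega), Nat.add_sub_add_left, Nat.add_sub_cancel_left]
        field_simp
      rw [Finset.sum_congr rfl h1, ← Finset.mul_sum, sum_s_mul_D]
      rcases eq_or_ne m 0 with rfl | hm
      · simp [W.r_ne]
      · simp [hm]
    · intro i hi
      rw [invMean, if_neg, mul_zero]
      have := Finset.mem_Ico.1 hi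
      omega

/-- The preimage of the `k`-th unit vector under the transform. -/
def basisSeq (k : ℕ) : ℕ → 𝕜 := W.invBand (W.invMean k)

theorem transform_basisSeq (k : ℕ) : W.transform (W.basisSeq k) = Pi.single k 1 := by
  rw [transform, basisSeq, band_invBand, genMean_invMean]

theorem basisSeq_eq_zero {j k : ℕ} (h : j < k) : W.basisSeq k j = 0 := by
  rw [basisSeq, invBand]
  refine Finset.sum_eq_zero fun i hi => ?_
  rw [invMean, if_neg, mul_zero]
  have := Finset.mem_range.1 hi
  omega

/-- Triangularity: it lets `invTransform y` be replaced by a finite combination of columns when a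
single entry is computed. -/
theorem transform_congr {x y : ℕ → 𝕜} {n : ℕ} (h : ∀ j ≤ n, x j = y j) :
    W.transform x n = W.transform y n := by
  rw [transform, transform, genMean, genMean]
  congr 1
  refine Finset.sum_congr rfl fun i hi => ?_
  have hi' := Nat.lt_succ_iff.1 (Finset.mem_range.1 hi)
  cases i with
  | zero => simp [band, h 0 hi']
  | succ i => simp [band, h _ hi', h i (by omega)]

theorem transform_sum (c : ℕ → 𝕜) (x : ℕ → ℕ → 𝕜) (s : Finset ℕ) :
    W.transform (∑ k ∈ s, c k • x k) = ∑ k ∈ s, c k • W.transform (x k) := by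
  let f : (ℕ → 𝕜) →ₗ[𝕜] (ℕ → 𝕜) := ⟨⟨W.transform, W.transform_add⟩, W.transform_smul⟩
  change f _ = ∑ k ∈ s, c k • f (x k)
  simp

/-- The inverse of the transform. -/
def invTransform (y : ℕ → 𝕜) (j : ℕ) : 𝕜 :=
  ∑ k ∈ Finset.range (j + 1), y k * W.basisSeq k j

theorem transform_invTransform (y : ℕ → 𝕜) : W.transform (W.invTransform y) = y := by
  funext n
  have h : W.transform (W.invTransform y) n =
      W.transform (∑ k ∈ Finset.range (n + 1), y k • W.basisSeq k) n := by
    refine W.transform_congr fun j hj => ?_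
    rw [Finset.sum_apply, invTransform]
    refine Finset.sum_subset (Finset.range_mono (by omega)) fun k _ hk => ?_
    rw [W.basisSeq_eq_zero (by simpa using hk), mul_zero]
  rw [h, transform_sum]
  simp [transform_basisSeq, Pi.single_apply]

theorem invTransform_transform (x : ℕ → 𝕜) : W.invTransform (W.transform x) = x := by
  have h : W.transform (W.invTransform (W.transform x) + (-1 : 𝕜) • x) = 0 := by
    rw [transform_add, transform_smul, transform_invTransform]; simp
  have := W.transform_injective h
  rwa [neg_one_smul, add_neg_eq_zero] at this

/-- Interchange of two finite sums. In the stated form the term `i = j = k` is split off, after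
which the inner sums for `i = k` and `i = k + 1` both start at `k + 1`. -/
theorem tildeTrunc_eq {a : ℕ → 𝕜} {N k : ℕ} (h : k ≤ N) :
    W.tildeTrunc a N k = ∑ j ∈ Finset.range (N + 1), a j * W.basisSeq k j := by
  have bot : ∀ (G : ℕ → 𝕜) {m : ℕ}, m ≤ N →
      ∑ i ∈ Finset.Icc m N, G i = G m + ∑ i ∈ Finset.Icc (m + 1) N, G i := by
    intro G m hm
    rw [← Finset.insert_Icc_add_one_left_eq_Icc hm, Finset.sum_insert (by simp)]
  set E : ℕ → 𝕜 := fun i => (-1) ^ (i - k) * (W.D (i - k) / W.t i)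
  set c : ℕ → ℕ → 𝕜 := fun i j => (-W.v) ^ (j - i) / W.u ^ (j - i + 1)
  have h1 : ∑ j ∈ Finset.range (N + 1), a j * W.basisSeq k j =
      W.r k * ∑ i ∈ Finset.Icc k N, E i * ∑ j ∈ Finset.Icc i N, c i j * a j := by
    have h2 : ∀ j ∈ Finset.range (N + 1), a j * W.basisSeq k j =
        ∑ i ∈ Finset.Icc k j, W.r k * (E i * (c i j * a j)) := by
      intro j _
      rw [basisSeq, invBand, Finset.mul_sum]
      symm
      refine Finset.sum_subset_zero_on_sdiff (fun i hi => ?_) (fun i hi => ?_) (fun i hi => ?_)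
      · simp only [Finset.mem_Icc, Finset.mem_range] at *; omega
      · rw [invMean, if_neg]
        · simp
        · simp only [Finset.mem_sdiff, Finset.mem_Icc, Finset.mem_range] at hi; omega
      · rw [invMean, if_pos (Finset.mem_Icc.1 hi).1]
        simp only [E, c]
        ring
    rw [Finset.sum_congr rfl h2, Finset.mul_sum]
    simp only [Finset.mul_sum]
    refine Finset.sum_comm' fun j i => ?_
    simp only [Finset.mem_Icc, Finset.mem_range]
    omega
  have hD : W.D 0 = 1 / W.s 0 := by simp [D]
  have h3 : ∑ i ∈ Finset.Icc k (k + 1), E i * ∑ j ∈ Finset.Icc (k + 1) N, c i j * a j =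
      E k * ∑ j ∈ Finset.Icc (k + 1) N, c k j * a j +
        E (k + 1) * ∑ j ∈ Finset.Icc (k + 1) N, c (k + 1) j * a j := by
    rw [← Finset.insert_Icc_add_one_left_eq_Icc (Nat.le_succ k), Finset.sum_insert (by simp)]
    simp
  have h4 : ∑ i ∈ Finset.Icc (k + 1) N, E i * ∑ j ∈ Finset.Icc i N, c i j * a j =
      E (k + 1) * ∑ j ∈ Finset.Icc (k + 1) N, c (k + 1) j * a j +
        ∑ i ∈ Finset.Icc (k + 2) N, E i * ∑ j ∈ Finset.Icc i N, c i j * a j := by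
    rcases Nat.lt_or_ge N (k + 1) with h' | h'
    · rw [Finset.Icc_eq_empty (by omega), Finset.Icc_eq_empty (a := k + 2) (by omega)]; simp
    · exact bot _ h'
  have h5 : E k * (c k k * a k) = a k / (W.s 0 * W.t k) * (1 / W.u) := by
    have := W.s_ne
    have := W.t_ne k
    have := W.u_ne
    simp only [E, c, Nat.sub_self, hD]
    field_simp
    simp [mul_comm]
  rw [h1, tildeTrunc, if_pos h, bot _ h, bot (fun j => c k j * a j) h, h4]
  change W.r k * (a k / (W.s 0 * W.t k) * (1 / W.u)
    + ∑ i ∈ Finset.Icc k (k + 1), E i * ∑ j ∈ Finset.Icc (k + 1) N, c i j * a j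
    + ∑ i ∈ Finset.Icc (k + 2) N, E i * ∑ j ∈ Finset.Icc i N, c i j * a j) = _
  rw [h3, mul_add (E k), h5]
  ring

theorem basisSeq_mem (p : ℝ≥0∞) (k : ℕ) : W.basisSeq k ∈ W.seqSpace p := by
  change Memℓp _ p
  rw [transform_basisSeq]
  exact (lp.single (E := fun _ : ℕ => 𝕜) p k 1).2

theorem norm_toLp (p : ℝ≥0∞) [Fact (1 ≤ p)] (x : W.Space p) : ‖W.toLp p x‖ = ‖x‖ := rfl

theorem toLp_surjective (p : ℝ≥0∞) : Function.Surjective (W.toLp p) := by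
  intro y
  have hy : W.invTransform y ∈ W.seqSpace p := by
    change Memℓp _ p
    rw [transform_invTransform]
    exact y.2
  exact ⟨⟨W.invTransform y, hy⟩, lp.ext (W.transform_invTransform y)⟩

/-- The isometric isomorphism between `l_p(r, s, t; B)` and `l_p`. -/
noncomputable def toLpIsometry (p : ℝ≥0∞) [Fact (1 ≤ p)] :
    W.Space p ≃ₗᵢ[𝕜] lp (fun _ : ℕ => 𝕜) p where
  toLinearEquiv := LinearEquiv.ofBijective (W.toLp p) ⟨W.toLp_injective p, W.toLp_surjective p⟩
  norm_map' := W.norm_toLp p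

theorem toSeq_toLpIsometry_symm (p : ℝ≥0∞) [Fact (1 ≤ p)] (y : lp (fun _ : ℕ => 𝕜) p) :
    W.toSeq p ((W.toLpIsometry p).symm y) = W.invTransform y := by
  have h : W.toLp p ((W.toLpIsometry p).symm y) = y := (W.toLpIsometry p).apply_symm_apply y
  have h1 : W.transform (W.toSeq p ((W.toLpIsometry p).symm y)) = y :=
    congrArg (fun z : lp (fun _ : ℕ => 𝕜) p => (z : ℕ → 𝕜)) h
  rw [← h1, invTransform_transform]

theorem toSeq_symm_single (p : ℝ≥0∞) [Fact (1 ≤ p)] (k : ℕ) :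
    W.toSeq p ((W.toLpIsometry p).symm (lp.single p k 1)) = W.basisSeq k := by
  rw [toSeq_toLpIsometry_symm, lp.coeFn_single, ← transform_basisSeq, invTransform_transform]

end Weights

/-! ### The Hausdorff measure of noncompactness -/

section HausdorffMNC

open Metric

theorem hausdorffMNC_nonneg {X : Type*} [PseudoMetricSpace X] (Q : Set X) :
    0 ≤ hausdorffMNC Q :=
  Real.sInf_nonneg fun _ h => h.1.le

theorem hausdorffMNC_le_of_cover {X : Type*} [PseudoMetricSpace X] [Nonempty X] {Q s : Set X}
    {ρ : ℝ} (hρ : 0 < ρ) (hs : s.Finite) (h : Q ⊆ ⋃ x ∈ s, ball x ρ) : hausdorffMNC Q ≤ ρ := by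
  refine le_of_forall_gt_imp_ge_of_dense fun ε hε => ?_
  obtain ⟨n, f, -, hf⟩ := hs.fin_param
  -- A spare centre, since the definition demands at least one ball even if `s` is empty.
  let x₀ : X := Classical.arbitrary X
  refine csInf_le ⟨0, fun _ h => h.1.le⟩ ⟨hρ.trans hε, n, Fin.cons x₀ f, fun _ => ρ,
    fun _ => ⟨hρ, hε⟩, fun z hz => ?_⟩
  obtain ⟨x, hx, hzx⟩ := Set.mem_iUnion₂.1 (h hz)
  rw [← hf] at hx
  obtain ⟨i, rfl⟩ := hx
  exact Set.mem_iUnion.2 ⟨i.succ, by simpa using hzx⟩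

theorem exists_cover_of_hausdorffMNC_lt {X : Type*} [PseudoMetricSpace X] [Nonempty X]
    {Q : Set X} (hQ : Bornology.IsBounded Q) {ε : ℝ} (h : hausdorffMNC Q < ε) :
    ∃ ρ, 0 < ρ ∧ ρ < ε ∧ ∃ s : Set X, s.Finite ∧ Q ⊆ ⋃ x ∈ s, ball x ρ := by
  -- Boundedness rules out the empty set, whose real infimum would be 0 by default.
  have hne : {ε : ℝ | 0 < ε ∧ ∃ (n : ℕ) (x : Fin (n + 1) → X) (ρ : Fin (n + 1) → ℝ),
      (∀ i, 0 < ρ i ∧ ρ i < ε) ∧ Q ⊆ ⋃ i, ball (x i) (ρ i)}.Nonempty := by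
    obtain ⟨r, hr, hQr⟩ := hQ.subset_ball_lt 0 (Classical.arbitrary X)
    exact ⟨r + 1, by positivity, 0, fun _ => Classical.arbitrary X, fun _ => r,
      fun _ => ⟨hr, by linarith⟩, fun z hz => Set.mem_iUnion.2 ⟨0, hQr hz⟩⟩
  obtain ⟨ε', ⟨-, n, x, ρ, hρ, hcov⟩, hε'⟩ := exists_lt_of_csInf_lt hne h
  obtain ⟨i₀, -, hi₀⟩ := Finset.exists_max_image Finset.univ ρ ⟨0, Finset.mem_univ _⟩
  refine ⟨ρ i₀, (hρ i₀).1, (hρ i₀).2.trans hε', Set.range x, Set.finite_range x, fun z hz => ?_⟩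
  obtain ⟨i, hi⟩ := Set.mem_iUnion.1 (hcov hz)
  exact Set.mem_iUnion₂.2 ⟨x i, ⟨i, rfl⟩, ball_subset_ball (hi₀ i (Finset.mem_univ i)) hi⟩

variable {𝕜 X Y : Type*} [RCLike 𝕜] [NormedAddCommGroup X] [NormedSpace 𝕜 X]
  [NormedAddCommGroup Y] [NormedSpace 𝕜 Y]

/-- A finite cover of the image of the unit sphere gives, with slightly larger radii, a finite
cover of the image of the closed unit ball. -/
theorem exists_cover_image_closedBall (L : X →ₗ[𝕜] Y) (hS : (sphere (0 : X) 1).Nonempty)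
    {s : Set Y} (hs : s.Finite) {ρ c : ℝ} (hρc : ρ < c)
    (h : L '' sphere 0 1 ⊆ ⋃ y ∈ s, ball y ρ) :
    ∃ s' : Set Y, s'.Finite ∧ L '' closedBall 0 1 ⊆ ⋃ y ∈ s', ball y c := by
  -- With `x = ‖x‖ • w` and `L w` near `y`, the point `L x` is within `ρ` of `‖x‖ • y`, which lies
  -- on the segment from 0 to `y`. Finitely many segments are compact and have a finite `(c -
  -- ρ)`-net.
  have hK : IsCompact (⋃ y ∈ s, (fun a : ℝ => (a : 𝕜) • y) '' Set.Icc 0 1) :=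
    hs.isCompact_biUnion fun y _ => isCompact_Icc.image (by fun_prop)
  obtain ⟨s', hs', hcov⟩ := totallyBounded_iff.1 hK.totallyBounded (c - ρ) (sub_pos.2 hρc)
  refine ⟨s', hs', ?_⟩
  rintro _ ⟨x, hx, rfl⟩
  have hx1 : ‖x‖ ≤ 1 := mem_closedBall_zero_iff.1 hx
  obtain ⟨w, hw, hxw⟩ : ∃ w ∈ sphere (0 : X) 1, x = (‖x‖ : 𝕜) • w := by
    rcases eq_or_ne x 0 with rfl | hx0
    · obtain ⟨w, hw⟩ := hS
      exact ⟨w, hw, by simp⟩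
    · have hn : (‖x‖ : 𝕜) ≠ 0 := by simpa using hx0
      refine ⟨(‖x‖ : 𝕜)⁻¹ • x, ?_, by rw [smul_inv_smul₀ hn]⟩
      rw [mem_sphere_zero_iff_norm, norm_smul, norm_inv, RCLike.norm_ofReal, abs_norm,
        inv_mul_cancel₀ (norm_ne_zero_iff.2 hx0)]
  obtain ⟨y, hy, hwy⟩ := Set.mem_iUnion₂.1 (h ⟨w, hw, rfl⟩)
  obtain ⟨k, hk, hyk⟩ := Set.mem_iUnion₂.1
    (hcov (Set.mem_iUnion₂.2 ⟨y, hy, ‖x‖, ⟨norm_nonneg x, hx1⟩, rfl⟩))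
  refine Set.mem_iUnion₂.2 ⟨k, hk, ?_⟩
  rw [mem_ball] at hwy hyk ⊢
  have h1 : dist (L x) ((‖x‖ : 𝕜) • y) ≤ ρ := by
    have hρ : 0 ≤ ρ := dist_nonneg.trans hwy.le
    calc dist (L x) ((‖x‖ : 𝕜) • y) = dist ((‖x‖ : 𝕜) • L w) ((‖x‖ : 𝕜) • y) := by
          rw [← map_smul, ← hxw]
      _ = ‖x‖ * dist (L w) y := by
          rw [dist_smul₀, RCLike.norm_ofReal, abs_norm]
      _ ≤ 1 * ρ := by gcongr
      _ = ρ := one_mul ρ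
  have h2 := dist_triangle (L x) ((‖x‖ : 𝕜) • y) k
  linarith

/-- A ball of radius `d'` about `a` is mapped into `L a + d' • L(closedBall 0 1)`, so scaling and
translating one cover of the image of the unit ball covers everything. -/
theorem hausdorffMNC_image_le (L : X →ₗ[𝕜] Y) (hL : Continuous L)
    (hS : (sphere (0 : X) 1).Nonempty) {Q : Set X} (hQ : Bornology.IsBounded Q) :
    hausdorffMNC (L '' Q) ≤ hausdorffMNC (L '' sphere 0 1) * hausdorffMNC Q := by
  have hLS : Bornology.IsBounded (L '' sphere (0 : X) 1) :=
    (⟨L, hL⟩ : X →L[𝕜] Y).lipschitz.isBounded_image isBounded_sphere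
  refine le_mul_of_forall_lt₀ fun c hc d hd => ?_
  obtain ⟨ρ, hρ, hρc, s, hs, hcov⟩ := exists_cover_of_hausdorffMNC_lt hLS hc
  obtain ⟨s', hs', hcov'⟩ := exists_cover_image_closedBall L hS hs hρc hcov
  obtain ⟨d', hd', hdd, s₂, hs₂, hcov₂⟩ := exists_cover_of_hausdorffMNC_lt hQ hd
  have hc0 : 0 < c := hρ.trans hρc
  have hle : hausdorffMNC (L '' Q) ≤ c * d' := by
    refine hausdorffMNC_le_of_cover (by positivity)
      (hs₂.image2 (fun a k => L a + (d' : 𝕜) • k) hs') ?_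
    rintro _ ⟨x, hx, rfl⟩
    obtain ⟨a, ha, hxa⟩ := Set.mem_iUnion₂.1 (hcov₂ hx)
    have hd0 : (d' : 𝕜) ≠ 0 := by exact_mod_cast hd'.ne'
    set w : X := (d' : 𝕜)⁻¹ • (x - a) with hw
    have hxw : x = a + (d' : 𝕜) • w := by rw [hw, smul_inv_smul₀ hd0]; abel
    have hwb : w ∈ closedBall (0 : X) 1 := by
      rw [mem_closedBall_zero_iff, hw, norm_smul, norm_inv, RCLike.norm_ofReal,
        abs_of_pos hd', inv_mul_le_iff₀ hd', mul_one, ← dist_eq_norm]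
      exact (mem_ball.1 hxa).le
    obtain ⟨k, hk, hwk⟩ := Set.mem_iUnion₂.1 (hcov' ⟨w, hwb, rfl⟩)
    refine Set.mem_iUnion₂.2 ⟨_, ⟨a, ha, k, hk, rfl⟩, ?_⟩
    rw [mem_ball] at hwk ⊢
    rw [hxw, map_add, map_smul, dist_add_left, dist_smul₀, RCLike.norm_ofReal, abs_of_pos hd',
      mul_comm]
    gcongr
  exact hle.trans (by gcongr)

theorem opMNC_eq_hausdorffMNC_image_sphere (L : X →ₗ[𝕜] Y) (hL : Continuous L)
    (hS : (sphere (0 : X) 1).Nonempty) : opMNC L = hausdorffMNC (L '' sphere 0 1) := by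
  have hmem : hausdorffMNC (L '' sphere 0 1) ∈ {K : ℝ | 0 ≤ K ∧ ∀ Q : Set X,
      Bornology.IsBounded Q → hausdorffMNC (L '' Q) ≤ K * hausdorffMNC Q} :=
    ⟨hausdorffMNC_nonneg _, fun _ hQ => hausdorffMNC_image_le L hL hS hQ⟩
  refine le_antisymm (csInf_le ⟨0, fun _ h => h.1⟩ hmem) (le_csInf ⟨_, hmem⟩ fun K hK => ?_)
  have h1 : hausdorffMNC (sphere (0 : X) 1) ≤ 1 := by
    refine le_of_forall_gt_imp_ge_of_dense fun ρ hρ => ?_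
    refine hausdorffMNC_le_of_cover (zero_lt_one.trans hρ) (Set.finite_singleton 0) ?_
    simpa using sphere_subset_ball hρ
  calc hausdorffMNC (L '' sphere 0 1) ≤ K * hausdorffMNC (sphere (0 : X) 1) :=
        hK.2 _ isBounded_sphere
    _ ≤ K * 1 := mul_le_mul_of_nonneg_left h1 hK.1
    _ = K := mul_one K

end HausdorffMNC

/-! ### Operators into `c` given by coordinate functionals -/

section OperatorsIntoC

open Metric

variable {𝕜 X : Type*} [RCLike 𝕜] [NormedAddCommGroup X] [NormedSpace 𝕜 X]

theorem norm_apply_le_norm_cSpace (z : cSpace 𝕜) (n : ℕ) :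
    ‖(z : lp (fun _ : ℕ => 𝕜) ∞) n‖ ≤ ‖z‖ :=
  lp.norm_apply_le_norm ENNReal.top_ne_zero _ n

theorem norm_cSpace_le {z : cSpace 𝕜} {C : ℝ} (h : ∀ n, ‖(z : lp (fun _ : ℕ => 𝕜) ∞) n‖ ≤ C) :
    ‖z‖ ≤ C :=
  lp.norm_le_of_forall_le' C h

/-- The sequence with the entries of `a` followed by the constant value `l`. -/
def eventuallyConst {r : ℕ} (a : Fin r → 𝕜) (l : 𝕜) (n : ℕ) : 𝕜 :=
  if h : n < r then a ⟨n, h⟩ else l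

theorem eventuallyConst_mem {r : ℕ} (a : Fin r → 𝕜) (l : 𝕜) :
    eventuallyConst a l ∈ convSeq 𝕜 := by
  refine ⟨l, tendsto_const_nhds.congr' ?_⟩
  filter_upwards [eventually_ge_atTop r] with n hn
  rw [eventuallyConst, dif_neg (not_lt.2 hn)]

variable {L : X →ₗ[𝕜] cSpace 𝕜} {F : ℕ → StrongDual 𝕜 X} {G : StrongDual 𝕜 X} {C : ℝ}

theorem continuous_of_coordinates (hF : ∀ x n, (L x : lp (fun _ : ℕ => 𝕜) ∞) n = F n x)
    (hC : ∀ n, ‖F n‖ ≤ C) : Continuous L := by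
  refine AddMonoidHomClass.continuous_of_bound L C fun x => norm_cSpace_le fun n => ?_
  rw [hF]
  exact (F n).le_of_opNorm_le (hC n) x

theorem hausdorffMNC_le_limsup (hF : ∀ x n, (L x : lp (fun _ : ℕ => 𝕜) ∞) n = F n x)
    (hC : ∀ n, ‖F n‖ ≤ C) :
    hausdorffMNC (L '' sphere 0 1) ≤ limsup (fun n => ‖F n - G‖) atTop := by
  have hbdd : IsBoundedUnder (· ≤ ·) atTop fun n => ‖F n - G‖ :=
    isBoundedUnder_of ⟨C + ‖G‖, fun n => (norm_sub_le _ _).trans (by gcongr; exact hC n)⟩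
  refine le_of_forall_gt_imp_ge_of_dense fun ε hε => ?_
  obtain ⟨ε', hε', hεε⟩ := exists_between hε
  obtain ⟨r, hr⟩ := eventually_atTop.1 (eventually_lt_of_limsup_lt hε' hbdd)
  have hε0 : 0 < ε' := (norm_nonneg _).trans_lt (hr r le_rfl)
  -- The limit functional is recorded with the first `r` coordinates, so that it can serve as the
  -- constant tail of a centre in `c`.
  let g : X →L[𝕜] (Fin r → 𝕜) × 𝕜 := (ContinuousLinearMap.pi fun i : Fin r => F i).prod G
  have hg : Bornology.IsBounded (g '' sphere 0 1) := g.lipschitz.isBounded_image isBounded_sphere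
  obtain ⟨s, hs, hcov⟩ := totallyBounded_iff.1
    (hg.isCompact_closure.totallyBounded.subset subset_closure) ((ε - ε') / 2)
      (half_pos (sub_pos.2 hεε))
  refine hausdorffMNC_le_of_cover (hε0.trans hεε)
    (hs.image fun al => (⟨⟨eventuallyConst al.1 al.2, memℓp_of_convSeq (eventuallyConst_mem _ _)⟩,
      eventuallyConst_mem _ _⟩ : cSpace 𝕜)) ?_
  rintro _ ⟨x, hx, rfl⟩
  obtain ⟨⟨a, l⟩, hal, hxal⟩ := Set.mem_iUnion₂.1 (hcov ⟨x, hx, rfl⟩)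
  refine Set.mem_iUnion₂.2 ⟨_, ⟨(a, l), hal, rfl⟩, ?_⟩
  have hx1 : ‖x‖ = 1 := mem_sphere_zero_iff_norm.1 hx
  rw [mem_ball, Prod.dist_eq, max_lt_iff] at hxal
  have hhead : ∀ i : Fin r, ‖F i x - a i‖ < (ε - ε') / 2 := fun i => by
    rw [← dist_eq_norm]
    exact (dist_le_pi_dist (fun i : Fin r => F i x) a i).trans_lt hxal.1
  have hlim : ‖G x - l‖ < (ε - ε') / 2 := by
    rw [← dist_eq_norm]
    exact hxal.2
  rw [mem_ball, dist_eq_norm]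
  -- The tail error is at most `ε' + (ε - ε') / 2`; the error in the first `r` entries is smaller.
  refine (norm_cSpace_le (C := (ε' + ε) / 2) fun n => ?_).trans_lt (by linarith)
  change ‖(L x : lp (fun _ : ℕ => 𝕜) ∞) n - eventuallyConst a l n‖ ≤ (ε' + ε) / 2
  rw [hF, eventuallyConst]
  split_ifs with hn
  · have h1 := hhead ⟨n, hn⟩
    change ‖F n x - a ⟨n, hn⟩‖ < _ at h1
    linarith
  · have h1 : ‖(F n - G) x‖ ≤ ε' := by
      simpa [hx1] using (F n - G).le_of_opNorm_le (hr n (not_lt.1 hn)).le x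
    have h2 : F n x - l = (F n - G) x + (G x - l) := by rw [sub_apply]; ring
    have h3 := norm_add_le ((F n - G) x) (G x - l)
    rw [h2]
    linarith

theorem half_limsup_le_hausdorffMNC (hF : ∀ x n, (L x : lp (fun _ : ℕ => 𝕜) ∞) n = F n x)
    (hG : ∀ x, Tendsto (fun n => F n x) atTop (𝓝 (G x))) (hL : Continuous L) :
    1 / 2 * limsup (fun n => ‖F n - G‖) atTop ≤ hausdorffMNC (L '' sphere 0 1) := by
  have hLS : Bornology.IsBounded (L '' sphere (0 : X) 1) :=
    (⟨L, hL⟩ : X →L[𝕜] cSpace 𝕜).lipschitz.isBounded_image isBounded_sphere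
  refine le_of_forall_gt_imp_ge_of_dense fun c hc => ?_
  obtain ⟨ρ, hρ, hρc, s, hs, hcov⟩ := exists_cover_of_hausdorffMNC_lt hLS hc
  choose l hl using fun z : cSpace 𝕜 => z.2
  -- The tolerance is chosen so that `ρ + 2 * (c - ρ) + ρ = 2 * c`; finiteness of `s` makes one `n`
  -- serve all centres.
  have hev : ∀ᶠ n in atTop, ∀ z ∈ s, ‖(z : lp (fun _ : ℕ => 𝕜) ∞) n - l z‖ < 2 * (c - ρ) := by
    refine (eventually_all_finite hs).2 fun z _ => ?_
    have h := (hl z).eventually (ball_mem_nhds (l z) (ε := 2 * (c - ρ)) (by linarith))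
    simpa only [mem_ball, dist_eq_norm] using h
  have hle : ∀ᶠ n in atTop, ‖F n - G‖ ≤ 2 * c := by
    filter_upwards [hev] with n hn
    refine (F n - G).opNorm_le_bound (by linarith) fun y => ?_
    have hb := LinearMap.bound_of_sphere_bound zero_lt_one (2 * c) (F n - G).toLinearMap
      (fun x hx => ?_) y
    · simpa using hb
    obtain ⟨z, hz, hxz⟩ := Set.mem_iUnion₂.1 (hcov ⟨x, hx, rfl⟩)
    rw [mem_ball, dist_eq_norm] at hxz
    have hcoord : ∀ m, ‖F m x - (z : lp (fun _ : ℕ => 𝕜) ∞) m‖ ≤ ρ := fun m => by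
      rw [← hF]
      exact (norm_apply_le_norm_cSpace (L x - z) m).trans hxz.le
    have hlim : ‖G x - l z‖ ≤ ρ :=
      le_of_tendsto ((hG x).sub (hl z)).norm (Eventually.of_forall hcoord)
    have h1 : (F n - G) x = (F n x - (z : lp (fun _ : ℕ => 𝕜) ∞) n) +
        ((z : lp (fun _ : ℕ => 𝕜) ∞) n - l z) - (G x - l z) := by
      rw [sub_apply]; ring
    have h2 := norm_sub_le ((F n x - (z : lp (fun _ : ℕ => 𝕜) ∞) n) +
        ((z : lp (fun _ : ℕ => 𝕜) ∞) n - l z)) (G x - l z)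
    have h3 := norm_add_le (F n x - (z : lp (fun _ : ℕ => 𝕜) ∞) n)
      ((z : lp (fun _ : ℕ => 𝕜) ∞) n - l z)
    have h4 := hcoord n
    have h5 := hn z hz
    change ‖(F n - G) x‖ ≤ 2 * c
    rw [h1]
    linarith
  have hlimsup : limsup (fun n => ‖F n - G‖) atTop ≤ 2 * c :=
    limsup_le_of_le (isCoboundedUnder_le_of_le atTop (x := 0) fun n => norm_nonneg _) hle
  linarith

end OperatorsIntoC

/-! ### Matrix rows as functionals, and the main theorem -/

theorem tendsto_sum_range_matTransform {𝕜 : Type*} [RCLike 𝕜] {A : Matrix ℕ ℕ 𝕜} {x : ℕ → 𝕜}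
    {n : ℕ} (h : Summable (fun k => A n k * x k) (conditional ℕ)) :
    Tendsto (fun N => ∑ k ∈ Finset.range N, A n k * x k) atTop (𝓝 (matTransform A x n)) := by
  have h1 := h.hasSum
  rwa [HasSum, conditional_filter_eq_map_range, tendsto_map'_iff] at h1

theorem tendsto_tildeTrunc {𝕜 : Type*} [RCLike 𝕜] {W : Weights 𝕜} {p : ℝ≥0∞} {A : Matrix ℕ ℕ 𝕜}
    (hA : A ∈ MatClass (W.seqSpace p : Set (ℕ → 𝕜)) (convSeq 𝕜)) (n k : ℕ) :
    Tendsto (fun N => W.tildeTrunc (A n) N k) atTop (𝓝 (matTransform A (W.basisSeq k) n)) := by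
  have h := tendsto_sum_range_matTransform ((hA _ (W.basisSeq_mem p k)).1 n)
  refine ((tendsto_add_atTop_iff_nat 1).2 h).congr' ?_
  filter_upwards [eventually_ge_atTop k] with N hN
  exact (W.tildeTrunc_eq hN).symm

section MatrixClass

variable {𝕜 : Type*} [RCLike 𝕜] {W : Weights 𝕜} {p : ℝ≥0∞} [Fact (1 ≤ p)] {A : Matrix ℕ ℕ 𝕜}

/-- Each partial sum involves finitely many coordinates of `y`, hence is continuous; by
Banach–Steinhaus so is the pointwise limit. -/
theorem exists_row_functional
    (hA : A ∈ MatClass (W.seqSpace p : Set (ℕ → 𝕜)) (convSeq 𝕜)) (n : ℕ) :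
    ∃ f : StrongDual 𝕜 (lp (fun _ : ℕ => 𝕜) p), ∀ y,
      f y = matTransform A (W.toSeq p ((W.toLpIsometry p).symm y)) n := by
  let g : ℕ → StrongDual 𝕜 (lp (fun _ : ℕ => 𝕜) p) := fun N =>
    ∑ j ∈ Finset.range N, A n j • ∑ k ∈ Finset.range (j + 1),
      W.basisSeq k j • lp.evalCLM 𝕜 (fun _ : ℕ => 𝕜) p k
  have hg : ∀ N y, g N y = ∑ j ∈ Finset.range N,
      A n j * W.toSeq p ((W.toLpIsometry p).symm y) j := by
    intro N y
    simp only [g, Weights.toSeq_toLpIsometry_symm, sum_apply, smul_apply, smul_eq_mul, Weights.invTransform]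
    refine Finset.sum_congr rfl fun j _ => congrArg _ (Finset.sum_congr rfl fun k _ => ?_)
    exact mul_comm _ _
  have hlim : Tendsto (fun N y => g N y) atTop
      (𝓝 fun y => matTransform A (W.toSeq p ((W.toLpIsometry p).symm y)) n) := by
    rw [tendsto_pi_nhds]
    intro y
    simp only [hg]
    exact tendsto_sum_range_matTransform ((hA _ (W.toSeq_mem _)).1 n)
  exact ⟨continuousLinearMapOfTendsto g hlim, fun _ => rfl⟩

end MatrixClass

theorem theorem5p2 {𝕜 : Type*} [RCLike 𝕜] (W : Weights 𝕜) (p q : ℝ≥0∞) [Fact (1 ≤ p)]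
    (hp : p ≠ ∞) (hpq : p.HolderConjugate q) (A : Matrix ℕ ℕ 𝕜)
    (hA : A ∈ MatClass (W.seqSpace p : Set (ℕ → 𝕜)) (convSeq 𝕜)) :
    Continuous (matOp hA) ∧
    opMNC (matOp hA) = hausdorffMNC (matOp hA '' Metric.sphere 0 1) ∧
    ∃ (Atilde : ℕ → lp (fun _ : ℕ => 𝕜) q) (α : lp (fun _ : ℕ => 𝕜) q),
      (∀ n k, Tendsto (fun N => W.tildeTrunc (A n) N k) atTop (𝓝 (Atilde n k))) ∧
      (∀ k, Tendsto (fun n => Atilde n k) atTop (𝓝 (α k))) ∧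
      BddAbove (Set.range fun n => ‖Atilde n - α‖) ∧
      1 / 2 * limsup (fun n => ‖Atilde n - α‖) atTop ≤ opMNC (matOp hA) ∧
      opMNC (matOp hA) ≤ limsup (fun n => ‖Atilde n - α‖) atTop := by
  choose f hf using exists_row_functional hA
  have hconv : ∀ y, ∃ l, Tendsto (fun n => f n y) atTop (𝓝 l) := fun y => by
    obtain ⟨l, hl⟩ := (hA _ (W.toSeq_mem ((W.toLpIsometry p).symm y))).2
    exact ⟨l, by simpa only [hf] using hl⟩
  choose g₀ hg₀ using hconv
  set g : StrongDual 𝕜 (lp (fun _ : ℕ => 𝕜) p) :=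
    continuousLinearMapOfTendsto f (tendsto_pi_nhds.2 hg₀)
  have hg : ∀ y, Tendsto (fun n => f n y) atTop (𝓝 (g y)) := hg₀
  -- Convergent scalar sequences are bounded, so the family `f` is pointwise bounded on the Banach
  -- space `l_p`.
  obtain ⟨C, hC⟩ := banach_steinhaus (g := f) fun y => by
    obtain ⟨c, hc⟩ := (hg y).norm.bddAbove_range
    exact ⟨c, fun n => hc ⟨n, rfl⟩⟩
  let Φ := W.toLpIsometry p
  let Φc : W.Space p →L[𝕜] lp (fun _ : ℕ => 𝕜) p := Φ.toLinearIsometry.toContinuousLinearMap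
  have hnorm : ∀ h : StrongDual 𝕜 (lp (fun _ : ℕ => 𝕜) p), ‖h.comp Φc‖ = ‖h‖ :=
    fun h => h.opNorm_comp_linearIsometryEquiv Φ
  have hF : ∀ x n, (matOp hA x : lp (fun _ : ℕ => 𝕜) ∞) n = (f n).comp Φc x := by
    intro x n
    change matTransform A (W.toSeq p x) n = f n (Φ x)
    rw [hf, LinearIsometryEquiv.symm_apply_apply]
  have hCF : ∀ n, ‖(f n).comp Φc‖ ≤ C := fun n => (hnorm _).trans_le (hC n)
  have hGF : ∀ x, Tendsto (fun n => (f n).comp Φc x) atTop (𝓝 (g.comp Φc x)) := fun x => hg (Φ x)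
  have hcont : Continuous (matOp hA) := continuous_of_coordinates hF hCF
  have hS : (Metric.sphere (0 : W.Space p) 1).Nonempty := by
    refine ⟨Φ.symm (lp.single p 0 1), ?_⟩
    rw [mem_sphere_zero_iff_norm, LinearIsometryEquiv.norm_map,
      lp.norm_single (zero_lt_one.trans_le Fact.out), norm_one]
  have hop := opMNC_eq_hausdorffMNC_image_sphere (matOp hA) hcont hS
  -- Passing to coefficients and composing with the isometry both preserve norms, so the bounds in
  -- terms of functionals are those in `l_q`.
  have hdiff : ∀ n, ‖lpDualSeq hp hpq (f n) - lpDualSeq hp hpq g‖ =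
      ‖(f n).comp Φc - g.comp Φc‖ := fun n => by
    rw [← lpDualSeq_sub, norm_lpDualSeq, ← ContinuousLinearMap.sub_comp, hnorm]
  refine ⟨hcont, hop, fun n => lpDualSeq hp hpq (f n), lpDualSeq hp hpq g, fun n k => ?_,
    fun k => hg (lp.single p k 1), ⟨C + ‖g.comp Φc‖, ?_⟩, ?_, ?_⟩
  · have h1 : lpDualSeq hp hpq (f n) k = matTransform A (W.basisSeq k) n := by
      rw [← W.toSeq_symm_single p k]
      exact hf n _
    rw [h1]
    exact tendsto_tildeTrunc hA n k
  · rintro _ ⟨n, rfl⟩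
    refine (hdiff n).trans_le ?_
    exact (norm_sub_le _ _).trans (by gcongr; exact hCF n)
  · simp only [hdiff, hop]
    exact half_limsup_le_hausdorffMNC hF hGF hcont
  · simp only [hdiff, hop]
    exact hausdorffMNC_le_limsup hF hCF
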